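/- Let $d\ge 2$, let $p\in\mathbb{C}[z]$ be a polynomial of degree $d$, and let $J_p$ be its Julia set, i.e. the boundary of the set of points of $\mathbb{C}$ with bounded forward orbit under $p$. Let $D_d=\frac12(d-1)(d+4)$. For $\lambda=(a_{j,k})_{0\le j\le d-2,\;0\le k\le d-j}\in\mathbb{C}^{D_d}$ and $z\in\mathbb{C}$ put $$q_{\lambda,z}(w)=w^d+\sum_{j=0}^{d-2}\Big(\sum_{k=0}^{d-j}(a_{j,k})^{d-j}z^k\Big)w^j ,$$ and let $Q^n_{\lambda,z}=q_{\lambda,z_{n-1}}\circ\cdots\circ q_{\lambda,z_0}$ for $n\ge 0$, where $z_k=p^k(z)$ and $p^k$ denotes the $k$-th iterate of $p$ (so that $Q^0_{\lambda,z}=\mathrm{id}$). Then the set $$\mathcal{C}=\bigcap_{z\in J_p}\big\{\lambda\in\mathbb{C}^{D_d}:\ \text{for every } c\in\mathbb{C} \text{ with } q_{\lambda,z}'(c)=0,\ \text{the sequence } (Q^n_{\lambda,z}(c))_{n\ge 0} \text{ is bounded}\big\}$$ is a compact subset of $\mathbb{C}^{D_d}$. -/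

import Mathlib

open Polynomial

namespace SkewProduct

/-- The filled Julia set `K_p` of a polynomial `p`: the points with bounded forward orbit. -/
def filledJulia (p : ℂ[X]) : Set ℂ :=
  {z | Bornology.IsBounded (Set.range fun n : ℕ => (fun x => p.eval x)^[n] z)}

/-- The Julia set `J_p = ∂K_p` of a polynomial `p`. -/
def julia (p : ℂ[X]) : Set ℂ :=
  frontier (filledJulia p)

/-- The pairs `(j, k)` with `0 ≤ j ≤ d - 2` and `0 ≤ k ≤ d - j`. -/
abbrev ParamIndex (d : ℕ) : Type :=
  Σ j : Fin (d - 1), Fin (d - (j : ℕ) + 1)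

/-- The parameter space `ℂ^{D_d}` of the tuples `(a_{j,k})`, with its usual topology. -/
abbrev Param (d : ℕ) : Type :=
  ParamIndex d → ℂ

/-- The number of parameters is `D_d = (d - 1)(d + 4) / 2`. -/
theorem card_paramIndex (d : ℕ) (hd : 2 ≤ d) :
    2 * Fintype.card (ParamIndex d) = (d - 1) * (d + 4) := by
  obtain ⟨m, rfl⟩ := Nat.exists_eq_add_of_le' hd
  simp only [Fintype.card_sigma, Fintype.card_fin]
  rw [Fin.sum_univ_eq_sum_range (fun j => m + 2 - j + 1) (m + 2 - 1)]
  induction m with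
  | zero => simp
  | succ m ih =>
    have ih' := ih (by omega)
    simp only [Nat.add_succ_sub_one] at ih' ⊢
    rw [Finset.sum_range_succ']
    have h : ∀ j ∈ Finset.range (m + 1), m + 1 + 2 - (j + 1) + 1 = m + 2 - j + 1 := by
      intro j _
      omega
    rw [Finset.sum_congr rfl h, mul_add, ih']
    simp only [Nat.sub_zero]
    ring

/-- The coefficient `A_{λ,j}(z) = ∑_{k=0}^{d-j} a_{j,k}^{d-j} z^k` of `w^j`. -/
noncomputable def coeffA {d : ℕ} (lam : Param d) (j : Fin (d - 1)) (z : ℂ) : ℂ :=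
  ∑ k : Fin (d - (j : ℕ) + 1), lam ⟨j, k⟩ ^ (d - (j : ℕ)) * z ^ (k : ℕ)

/-- The polynomial `q_{λ,z}(w) = w^d + ∑_{j=0}^{d-2} A_{λ,j}(z) w^j` in the variable `w`. -/
noncomputable def fiberPoly {d : ℕ} (lam : Param d) (z : ℂ) : ℂ[X] :=
  X ^ d + ∑ j : Fin (d - 1), C (coeffA lam j z) * X ^ (j : ℕ)

/-- The critical set `C_{λ,z}` of `q_{λ,z}`. -/
def critSet {d : ℕ} (lam : Param d) (z : ℂ) : Set ℂ :=
  {c | (derivative (fiberPoly lam z)).eval c = 0}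

/-- The non-autonomous iterates `Q^n_{λ,z} = q_{λ,z_{n-1}} ∘ ⋯ ∘ q_{λ,z_0}`, `z_k = p^k(z)`. -/
noncomputable def fiberIter {d : ℕ} (p : ℂ[X]) (lam : Param d) (z : ℂ) : ℕ → ℂ → ℂ
  | 0, w => w
  | n + 1, w => (fiberPoly lam ((fun x => p.eval x)^[n] z)).eval (fiberIter p lam z n w)

/-- The filled Julia set `K_z(f_λ)` above `z` of `f_λ(z, w) = (p(z), q_{λ,z}(w))`. -/
def filledJuliaAbove {d : ℕ} (p : ℂ[X]) (lam : Param d) (z : ℂ) : Set ℂ :=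
  {w | Bornology.IsBounded (Set.range fun n : ℕ => fiberIter p lam z n w)}

/-- The locus of the parameters all of whose critical points above `J_p` have bounded orbit. -/
def connectednessLocus (d : ℕ) (p : ℂ[X]) : Set (Param d) :=
  ⋂ z ∈ julia p, {lam | ∀ c ∈ critSet lam z, c ∈ filledJuliaAbove p lam z}

end SkewProduct

/-! The heart is a bound independent of the parameter: if `lam` is in the locus and `z ∈ J_p`, then
`K_z` lies in the disk of radius 8 (`norm_le_of_mem_filledJuliaAbove`). All fibres over `J_p` lie in
some disk of radius `R`, where `R` depends on `lam`. The polynomial `Q^n_z` is monic and centred, of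
degree `N = d ^ n`, and its critical points lie in `K_z`, so its critical values have modulus at
most `R`. Hence any two of its roots are joined inside `{|Q^n_z| ≤ R}`. Projecting to a line and
applying Chebyshev's inequality puts the roots in the disk of radius `4 R ^ (1 / N)`, and each point
of `K_z` is within `R ^ (1 / N)` of a root. Letting `n` grow removes the dependence on `R`.

Boundedness: for a critical value `v` of `q_z`, all roots of `q_z - v` lie in `K_z`, so Vieta bounds
the coefficients `A_{λ,j}(z)` for `z ∈ J_p`. Since `J_p` is infinite, interpolation then bounds each
`a_{j,k}`.

Closedness: the uniform bound turns "bounded critical orbit" into the conditions `|Q^n_z(c)| ≤ 8`,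
each of which is closed because critical points vary continuously with the parameter. -/

namespace SkewProduct

/-! ### Connectedness of polynomial sublevel sets -/

/-- A decreasing intersection of compact preconnected sets is preconnected. -/
theorem isPreconnected_iInter_of_antitone {X : Type*} [TopologicalSpace X] [T2Space X]
    {V : ℕ → Set X} (hV : Antitone V) (hc : ∀ n, IsCompact (V n))
    (hp : ∀ n, IsPreconnected (V n)) : IsPreconnected (⋂ n, V n) := by
  have hcl : ∀ n, IsClosed (V n) := fun n => (hc n).isClosed
  have hK : IsCompact (⋂ n, V n) :=
    (hc 0).of_isClosed_subset (isClosed_iInter hcl) (Set.iInter_subset _ 0)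
  rw [isPreconnected_closed_iff]
  intro t t' ht ht' hsub hne hne'
  by_contra hcon
  have hdisj : Disjoint ((⋂ n, V n) ∩ t) ((⋂ n, V n) ∩ t') := by
    rw [Set.disjoint_left]
    exact fun x hx hx' => hcon ⟨x, hx.1, hx.2, hx'.2⟩
  obtain ⟨U, U', hU, hU', hUs, hUs', hUU⟩ :=
    SeparatedNhds.of_isCompact_isCompact (hK.inter_right ht) (hK.inter_right ht') hdisj
  obtain ⟨n, hn⟩ := exists_subset_nhds_of_isCompact' (V := V) (U := U ∪ U')
    (directed_of_isDirected_le fun i j hij => hV hij) hc hcl (by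
      intro x hx
      refine (hU.union hU').mem_nhds ?_
      rcases hsub hx with h | h
      · exact Or.inl (hUs ⟨hx, h⟩)
      · exact Or.inr (hUs' ⟨hx, h⟩))
  obtain ⟨x, hx⟩ := hne
  obtain ⟨y, hy⟩ := hne'
  obtain ⟨w, -, hw⟩ := hp n U U' hU hU' hn ⟨x, Set.mem_iInter.1 hx.1 n, hUs hx⟩
    ⟨y, Set.mem_iInter.1 hy.1 n, hUs' hy⟩
  exact Set.disjoint_left.1 hUU hw.1 hw.2

theorem isCompact_norm_eval_le {P : ℂ[X]} (hP : 0 < P.degree) (r : ℝ) :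
    IsCompact {w : ℂ | ‖P.eval w‖ ≤ r} := by
  refine Metric.isCompact_of_isClosed_isBounded
    (isClosed_le (P.continuous.norm) continuous_const) ?_
  have h := P.tendsto_norm_atTop hP (tendsto_norm_cobounded_atTop (E := ℂ))
  have h2 := h.eventually (Filter.eventually_gt_atTop r)
  rw [← Bornology.isCobounded_compl_iff]
  filter_upwards [h2] with w hw
  simpa using hw

theorem isClosed_connectedComponentIn_of_isClosed {X : Type*} [TopologicalSpace X] {F : Set X}
    (hF : IsClosed F) (x : X) : IsClosed (connectedComponentIn F x) := by
  by_cases hx : x ∈ F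
  · refine isClosed_of_closure_subset ?_
    exact isPreconnected_connectedComponentIn.closure.subset_connectedComponentIn
      (subset_closure (mem_connectedComponentIn hx))
      (hF.closure_subset_iff.2 (connectedComponentIn_subset F x))
  · rw [connectedComponentIn_eq_empty hx]
    exact isClosed_empty

theorem isCompact_segment (a b : ℂ) : IsCompact (segment ℝ a b) := by
  rw [segment_eq_image_lineMap]
  exact isCompact_Icc.image AffineMap.lineMap_continuous

/-- Near a point that is not critical, the sublevel set `{|P| < r}` is locally connected and its
closure is locally `{|P| ≤ r}`. -/
theorem exists_nhds_sublevel_preconnected {P : ℂ[X]} {r : ℝ} {x : ℂ} (hr : 0 < r)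
    (hx : (derivative P).eval x ≠ 0) :
    ∃ W : Set ℂ, IsOpen W ∧ x ∈ W ∧ IsPreconnected (W ∩ {w | ‖P.eval w‖ < r}) ∧
      W ∩ {w | ‖P.eval w‖ ≤ r} ⊆ closure (W ∩ {w | ‖P.eval w‖ < r}) := by
  have hd := (P.hasStrictDerivAt x).hasStrictFDerivAt_equiv hx
  let e := hd.toOpenPartialHomeomorph (fun w => P.eval w)
  have he : ∀ w, e w = P.eval w := fun w => rfl
  have hxs : x ∈ e.source := hd.mem_toOpenPartialHomeomorph_source
  obtain ⟨δ, hδ, hball⟩ := Metric.isOpen_iff.1 e.open_target _ (e.map_source hxs)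
  set B := Metric.ball (e x) δ with hB
  have hWU : e.source ∩ e ⁻¹' B ∩ {w | ‖P.eval w‖ < r} = e.symm '' (B ∩ Metric.ball 0 r) := by
    ext w
    constructor
    · rintro ⟨⟨hw, hwB⟩, hwr⟩
      exact ⟨e w, ⟨hwB, by simpa [he] using hwr⟩, e.left_inv hw⟩
    · rintro ⟨y, ⟨hyB, hyr⟩, rfl⟩
      have hyt := hball hyB
      refine ⟨⟨e.map_target hyt, ?_⟩, ?_⟩
      · simpa [e.right_inv hyt] using hyB
      · change ‖P.eval (e.symm y)‖ < r
        rw [← he, e.right_inv hyt]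
        simpa using hyr
  have hcont : ContinuousOn e.symm (B ∩ Metric.ball 0 r) :=
    e.continuousOn_symm.mono (Set.inter_subset_left.trans hball)
  refine ⟨e.source ∩ e ⁻¹' B, e.isOpen_inter_preimage Metric.isOpen_ball,
    ⟨hxs, Metric.mem_ball_self hδ⟩, ?_, ?_⟩
  · rw [hWU]
    exact (((convex_ball _ _).inter (convex_ball _ _)).isPreconnected).image _ hcont
  · rw [hWU]
    rintro w ⟨⟨hw, hwB⟩, hwr⟩
    rw [← e.left_inv hw]
    have hmem : e w ∈ closure (B ∩ Metric.ball 0 r) := by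
      refine Metric.isOpen_ball.inter_closure ⟨hwB, ?_⟩
      rw [closure_ball _ hr.ne']
      simpa [he] using hwr
    have hca : ContinuousWithinAt e.symm (B ∩ Metric.ball 0 r) (e w) :=
      (e.continuousAt_symm (hball hwB)).continuousWithinAt
    exact hca.mem_closure_image hmem

/-- If no critical point of `P` lies in `{|P| > R}`, then any two roots of `P` lie in a common
preconnected subset of `{|P| ≤ R}`. -/
theorem exists_preconnected_sublevel {P : ℂ[X]} (hP : 0 < P.degree) {R : ℝ} (hR : 0 ≤ R)
    (hcrit : ∀ c, (derivative P).eval c = 0 → ‖P.eval c‖ ≤ R) {a b : ℂ} (ha : P.eval a = 0)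
    (hb : P.eval b = 0) :
    ∃ S : Set ℂ, IsPreconnected S ∧ a ∈ S ∧ b ∈ S ∧ ∀ w ∈ S, ‖P.eval w‖ ≤ R := by
  let E : ℝ → Set ℂ := fun r => {w | ‖P.eval w‖ ≤ r}
  let T : Set ℝ := {r | 0 ≤ r ∧ b ∈ connectedComponentIn (E r) a}
  have haE : ∀ r, 0 ≤ r → a ∈ E r := fun r hr => by simpa [E, ha] using hr
  have hTof : ∀ (S : Set ℂ) (r : ℝ), 0 ≤ r → IsPreconnected S → a ∈ S → b ∈ S → S ⊆ E r → r ∈ T :=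
    fun S r hr hS haS hbS hSE => ⟨hr, hS.subset_connectedComponentIn haS hSE hbS⟩
  have hTne : T.Nonempty := by
    obtain ⟨r, hr⟩ := ((isCompact_segment a b).image P.continuous).isBounded.exists_norm_le
    refine ⟨max r 0, hTof (segment ℝ a b) _ (le_max_right _ _) (convex_segment a b).isPreconnected
      (left_mem_segment ℝ a b) (right_mem_segment ℝ a b) fun w hw => ?_⟩
    exact (hr _ ⟨w, hw, rfl⟩).trans (le_max_left _ _)
  have hTbdd : BddBelow T := ⟨0, fun r hr => hr.1⟩
  -- `ρ` is the lowest level at which `a` and `b` are joined. Compactness shows that it is attained,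
  -- by `S`; a level `ρ > R` carries no critical point and could be lowered.
  set ρ := sInf T with hρ
  have hρ0 : 0 ≤ ρ := le_csInf hTne fun r hr => hr.1
  have hmono : ∀ r s, r ≤ s → E r ⊆ E s := fun r s hrs w hw => le_trans hw hrs
  have hup : ∀ r, ρ < r → r ∈ T := by
    intro r hr
    obtain ⟨s, hs, hsr⟩ := exists_lt_of_csInf_lt hTne hr
    exact ⟨hs.1.trans hsr.le, connectedComponentIn_mono a (hmono s r hsr.le) hs.2⟩
  let V : ℕ → Set ℂ := fun n => connectedComponentIn (E (ρ + 1 / ((n : ℝ) + 1))) a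
  have hnpos : ∀ n : ℕ, 0 < 1 / ((n : ℝ) + 1) := fun n => Nat.one_div_pos_of_nat
  have hVanti : Antitone V := by
    intro m n hmn
    apply connectedComponentIn_mono
    apply hmono
    gcongr
  have hVc : ∀ n, IsCompact (V n) := fun n =>
    (isCompact_norm_eval_le hP _).of_isClosed_subset
      (isClosed_connectedComponentIn_of_isClosed (isCompact_norm_eval_le hP _).isClosed a) (connectedComponentIn_subset _ _)
  have hS := isPreconnected_iInter_of_antitone hVanti hVc fun n => isPreconnected_connectedComponentIn
  set S := ⋂ n, V n with hSdef
  have haS : a ∈ S := Set.mem_iInter.2 fun n =>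
    mem_connectedComponentIn (haE _ (by have := hnpos n; linarith))
  have hbS : b ∈ S := Set.mem_iInter.2 fun n =>
    (hup _ (by have := hnpos n; linarith)).2
  have hSρ : ∀ w ∈ S, ‖P.eval w‖ ≤ ρ := by
    intro w hw
    refine le_of_forall_pos_lt_add fun ε hε => ?_
    obtain ⟨n, hn⟩ := exists_nat_one_div_lt hε
    have : ‖P.eval w‖ ≤ ρ + 1 / ((n : ℝ) + 1) :=
      connectedComponentIn_subset (E _) a (Set.mem_iInter.1 hw n)
    linarith
  rcases le_or_gt ρ R with hle | hlt
  · exact ⟨S, hS, haS, hbS, fun w hw => (hSρ w hw).trans hle⟩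
  exfalso
  have hρpos : 0 < ρ := hR.trans_lt hlt
  let U : Set ℂ := {w | ‖P.eval w‖ < ρ}
  have hUo : IsOpen U := isOpen_lt P.continuous.norm continuous_const
  have haU : a ∈ U := by simpa [U, ha] using hρpos
  have hbU : b ∈ U := by simpa [U, hb] using hρpos
  set A := connectedComponentIn U a with hA
  have hAo : IsOpen A := hUo.connectedComponentIn
  have hAcl : ∀ x ∈ U, x ∈ closure A → x ∈ A := by
    intro x hxU hxA
    have h2 : IsPreconnected (insert x A) := by
      refine isPreconnected_connectedComponentIn.subset_closure (Set.subset_insert _ _) ?_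
      exact Set.insert_subset hxA subset_closure
    exact h2.subset_connectedComponentIn (Set.mem_insert_of_mem _ (mem_connectedComponentIn haU))
      (Set.insert_subset hxU (connectedComponentIn_subset _ _)) (Set.mem_insert _ _)
  have hbA : b ∈ A := by
    -- The absence of critical points at level `ρ` makes `closure A` open relative to `S`. If it
    -- missed `b`, it would split the preconnected set `S`.
    let O : Set ℂ := {x | ∃ W : Set ℂ, IsOpen W ∧ x ∈ W ∧ W ∩ E ρ ⊆ closure A}
    have hO : IsOpen O := by
      rw [isOpen_iff_forall_mem_open]
      rintro x ⟨W, hW, hxW, hWA⟩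
      exact ⟨W, fun y hy => ⟨W, hW, hy, hWA⟩, hW, hxW⟩
    have hAO : ∀ x ∈ S, x ∈ closure A → x ∈ O := by
      intro x hxS hxA
      rcases (hSρ x hxS).lt_or_eq with h | h
      · exact ⟨A, hAo, hAcl x h hxA, fun y hy => subset_closure hy.1⟩
      · have hxc : (derivative P).eval x ≠ 0 := fun h0 => by
          have := hcrit x h0
          linarith
        obtain ⟨W, hW, hxW, hWp, hWcl⟩ := exists_nhds_sublevel_preconnected hρpos hxc
        refine ⟨W, hW, hxW, hWcl.trans (closure_mono ?_)⟩
        obtain ⟨y, hyW, hyA⟩ := mem_closure_iff.1 hxA W hW hxW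
        have := hWp.subset_connectedComponentIn
          ⟨hyW, connectedComponentIn_subset _ _ hyA⟩ Set.inter_subset_right
        rwa [← connectedComponentIn_eq hyA] at this
    by_contra hbA
    obtain ⟨y, hyS, ⟨W, -, hyW, hWA⟩, hyA⟩ := hS O (closure A)ᶜ hO isClosed_closure.isOpen_compl
      (fun x hx => (em (x ∈ closure A)).imp (hAO x hx) id)
      ⟨a, haS, hAO a haS (subset_closure (mem_connectedComponentIn haU))⟩
      ⟨b, hbS, fun h => hbA (hAcl b hbU h)⟩
    exact hyA (hWA ⟨hyW, hSρ y hyS⟩)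
  -- A path from `a` to `b` in the open component `A` has a maximal level strictly below `ρ`,
  -- against the minimality of `ρ`.
  have hAp : IsPathConnected A := (hAo.isConnected_iff_isPathConnected).1
    (isConnected_connectedComponentIn_iff.2 haU)
  obtain ⟨γ, hγ⟩ := hAp.joinedIn a (mem_connectedComponentIn haU) b hbA
  obtain ⟨t, -, ht⟩ := isCompact_univ.exists_isMaxOn (Set.univ_nonempty (α := unitInterval))
    ((P.continuous.comp γ.continuous).norm.continuousOn)
  have htU : ‖P.eval (γ t)‖ < ρ := connectedComponentIn_subset U a (hγ t)
  have hmemT : ‖P.eval (γ t)‖ ∈ T := by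
    refine hTof (Set.range γ) _ (norm_nonneg _) (isPreconnected_range γ.continuous)
      ⟨0, γ.source⟩ ⟨1, γ.target⟩ ?_
    rintro _ ⟨s, rfl⟩
    exact ht (Set.mem_univ s)
  exact absurd (csInf_le hTbdd hmemT) (not_le.2 htU)

/-! ### Location of roots and Chebyshev's inequality -/

theorem pow_card_le_prod_map {α : Type*} (s : Multiset α) {f : α → ℝ} {m : ℝ} (hm : 0 ≤ m)
    (h : ∀ x ∈ s, m ≤ f x) : m ^ s.card ≤ (s.map f).prod := by
  induction s using Multiset.induction with
  | empty => simp
  | cons a s ih =>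
    rw [Multiset.card_cons, Multiset.map_cons, Multiset.prod_cons, pow_succ']
    exact mul_le_mul (h a (Multiset.mem_cons_self a s))
      (ih fun x hx => h x (Multiset.mem_cons_of_mem hx)) (by positivity)
      (hm.trans (h a (Multiset.mem_cons_self a s)))

theorem norm_eval_eq_prod_roots (P : ℂ[X]) (w : ℂ) :
    ‖P.eval w‖ = ‖P.leadingCoeff‖ * (P.roots.map fun z => ‖w - z‖).prod := by
  rw [(IsAlgClosed.splits P).eval_eq_prod_roots w, norm_mul]
  congr 1
  have := map_multiset_prod (normHom (α := ℂ)) (P.roots.map fun z => w - z)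
  simpa [Multiset.map_map] using this

/-- In the factorisation of `P` every factor is at least the distance to the nearest root. With a
fixed leading coefficient this also serves as continuity of roots. -/
theorem exists_root_near (P : ℂ[X]) (hP : P.natDegree ≠ 0) (w : ℂ) :
    ∃ ζ, P.eval ζ = 0 ∧ ‖P.leadingCoeff‖ * ‖w - ζ‖ ^ P.natDegree ≤ ‖P.eval w‖ := by
  have hcard : P.roots.card = P.natDegree := (IsAlgClosed.splits P).natDegree_eq_card_roots.symm
  have hne : P.roots.toFinset.Nonempty := by
    rw [Multiset.toFinset_nonempty]
    intro h
    rw [h] at hcard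
    exact hP (by simpa using hcard.symm)
  obtain ⟨ζ, hζ, hmin⟩ := P.roots.toFinset.exists_min_image (fun z => ‖w - z‖) hne
  refine ⟨ζ, (mem_roots'.1 (Multiset.mem_toFinset.1 hζ)).2, ?_⟩
  rw [norm_eval_eq_prod_roots, ← hcard]
  gcongr
  exact pow_card_le_prod_map _ (norm_nonneg _) fun x hx => hmin x (Multiset.mem_toFinset.2 hx)

/-- Chebyshev's inequality on an interval. -/
theorem pow_le_of_abs_eval_le {Q : ℝ[X]} (hQ : Q.Monic) (hN : Q.natDegree ≠ 0) {α β R : ℝ}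
    (hαβ : α ≤ β) (hR : 0 < R) (h : ∀ x ∈ Set.Icc α β, |Q.eval x| ≤ R) :
    ((β - α) / 4) ^ Q.natDegree ≤ R := by
  rcases hαβ.eq_or_lt with rfl | hlt
  · simpa [hN] using hR.le
  set r := (β - α) / 2 with hr
  have hr0 : 0 < r := by rw [hr]; linarith
  set L : ℝ[X] := C r * X + C ((α + β) / 2) with hL
  have hLd : L.natDegree = 1 := natDegree_linear hr0.ne'
  have hLl : L.leadingCoeff = r := leadingCoeff_linear hr0.ne'
  set G : ℝ[X] := C R⁻¹ * Q.comp L with hG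
  have hGl : G.leadingCoeff = R⁻¹ * r ^ Q.natDegree := by
    rw [hG, leadingCoeff_mul, leadingCoeff_C, leadingCoeff_comp (by rw [hLd]; simp), hQ, hLl,
      one_mul]
  have hGd : G.degree ≤ (Q.natDegree : ℕ) := by
    refine degree_le_of_natDegree_le ?_
    rw [hG, natDegree_C_mul (inv_ne_zero hR.ne'), natDegree_comp, hLd, mul_one]
  have key := Polynomial.Chebyshev.leadingCoeff_le_of_forall_abs_le_one hGd (by
    intro x hx
    rw [hG, eval_mul, eval_C, eval_comp, abs_mul, abs_of_pos (inv_pos.2 hR), inv_mul_le_one₀ hR]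
    apply h
    simp only [hL, eval_add, eval_mul, eval_C, eval_X]
    constructor <;> nlinarith [hx.1, hx.2])
  rw [hGl, inv_mul_le_iff₀ hR] at key
  -- The sharp inequality has an extra factor 2, which is given up here.
  have h2 : (2 : ℝ) ^ (Q.natDegree - 1) ≤ 2 ^ Q.natDegree :=
    pow_le_pow_right₀ (by norm_num) (Nat.sub_le _ _)
  have h3 : (β - α) / 4 = r / 2 := by rw [hr]; ring
  rw [h3, div_pow, div_le_iff₀ (by positivity)]
  exact key.trans (mul_le_mul_of_nonneg_left h2 hR.le)

/-- A monic polynomial with barycentre of roots at `0` and all critical values in the disk of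
radius `R` has its roots in the disk of radius `4 R ^ (1 / N)`. -/
theorem norm_root_pow_le {P : ℂ[X]} (hP : P.Monic) (hN : P.natDegree ≠ 0)
    (hsum : P.roots.sum = 0) {R : ℝ} (hR : 0 < R)
    (hcrit : ∀ c, (derivative P).eval c = 0 → ‖P.eval c‖ ≤ R) {ζ : ℂ} (hζ : P.eval ζ = 0) :
    (‖ζ‖ / 4) ^ P.natDegree ≤ R := by
  rcases eq_or_ne ζ 0 with rfl | hζ0
  · simpa [hN] using hR.le
  have hnζ : (‖ζ‖ : ℂ) ≠ 0 := by simpa using hζ0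
  -- Rotation by `u` sends `ζ` to the positive real axis, and `f` is the real part after it. As the
  -- roots sum to 0, some root `ξ` has `f ξ ≤ 0`, so the projection of `S` covers an interval of
  -- length at least `‖ζ‖`.
  set u : ℂ := (starRingEnd ℂ) ζ / ‖ζ‖ with hu
  have hun : ‖u‖ = 1 := by simp [hu, hζ0]
  let f : ℂ →+ ℝ := Complex.reAddGroupHom.comp (AddMonoidHom.mulLeft u)
  have hf : ∀ w, f w = (u * w).re := fun w => rfl
  have hfle : ∀ v w, |f v - f w| ≤ ‖v - w‖ := by
    intro v w
    rw [← map_sub, hf]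
    refine (Complex.abs_re_le_norm _).trans ?_
    rw [norm_mul, hun, one_mul]
  have hfζ : f ζ = ‖ζ‖ := by
    have : u * ζ = (‖ζ‖ : ℂ) := by
      rw [hu, div_mul_eq_mul_div, mul_comm, Complex.mul_conj, Complex.normSq_eq_norm_sq]
      field_simp
      push_cast
      ring
    rw [hf, this, Complex.ofReal_re]
  have hroot : ζ ∈ P.roots := mem_roots'.2 ⟨hP.ne_zero, hζ⟩
  obtain ⟨ξ, hξ, hfξ⟩ : ∃ ξ ∈ P.roots, f ξ ≤ 0 := by
    by_contra! hcon
    have h0 : (P.roots.map f).sum = 0 := by rw [← map_multiset_sum, hsum, map_zero]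
    have h1 : ∀ x ∈ P.roots.map f, 0 ≤ x := by
      intro x hx
      obtain ⟨y, hy, rfl⟩ := Multiset.mem_map.1 hx
      exact (hcon y hy).le
    have h2 := Multiset.single_le_sum h1 (f ζ) (Multiset.mem_map_of_mem f hroot)
    exact absurd (hcon ζ hroot) (not_lt.2 (h2.trans h0.le))
  obtain ⟨S, hS, hζS, hξS, hSR⟩ := exists_preconnected_sublevel
    (natDegree_pos_iff_degree_pos.1 (Nat.pos_of_ne_zero hN)) hR.le hcrit hζ (mem_roots'.1 hξ).2
  -- Projection shortens the distances to the roots, so `|Q|` on the line is dominated by `|P|` on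
  -- `S`.
  set Q : ℝ[X] := (P.roots.map fun z => X - C (f z)).prod with hQ
  have hQm : Q.Monic := monic_multiset_prod_of_monic _ _ fun z _ => monic_X_sub_C _
  have hQd : Q.natDegree = P.natDegree := by
    have := natDegree_multiset_prod_X_sub_C_eq_card (P.roots.map f)
    rw [Multiset.map_map, Multiset.card_map] at this
    exact this.trans (IsAlgClosed.splits P).natDegree_eq_card_roots.symm
  have hQle : ∀ w, |Q.eval (f w)| ≤ ‖P.eval w‖ := by
    intro w
    rw [norm_eval_eq_prod_roots, hP, norm_one, one_mul, hQ, eval_multiset_prod, Multiset.map_map]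
    have h1 := map_multiset_prod (absHom (α := ℝ))
      (P.roots.map ((eval (f w)) ∘ fun z => X - C (f z)))
    rw [Multiset.map_map] at h1
    refine (h1.le).trans ?_
    apply Multiset.prod_map_le_prod_map₀
    · intro z _; exact abs_nonneg _
    · intro z _
      simpa [absHom] using hfle w z
  have hfc : Continuous f := Complex.continuous_re.comp (continuous_const.mul continuous_id)
  have hcover : Set.Icc (f ξ) (f ζ) ⊆ f '' S := by
    exact hS.intermediate_value hξS hζS hfc.continuousOn
  have hξζ : f ξ ≤ f ζ := by
    rw [hfζ]; exact hfξ.trans (norm_nonneg _)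
  have key := pow_le_of_abs_eval_le hQm (hQd ▸ hN) hξζ hR (by
    intro x hx
    obtain ⟨w, hw, rfl⟩ := hcover hx
    exact (hQle w).trans (hSR w hw))
  rw [hQd] at key
  refine le_trans (pow_le_pow_left₀ (by positivity) ?_ _) key
  rw [hfζ]
  linarith

/-! ### The Julia set of the base polynomial -/

theorem norm_lt_of_isBounded_range {x : ℕ → ℂ} {ρ : ℝ} (hρ : 0 < ρ)
    (h : ∀ n, ρ ≤ ‖x n‖ → 2 * ‖x n‖ ≤ ‖x (n + 1)‖) (hb : Bornology.IsBounded (Set.range x)) :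
    ‖x 0‖ < ρ := by
  by_contra! h0
  have hgrow : ∀ n, ρ ≤ ‖x n‖ ∧ 2 ^ n * ρ ≤ ‖x n‖ := by
    intro n
    induction n with
    | zero => simpa using h0
    | succ n ih =>
      have := h n ih.1
      rw [pow_succ]
      constructor <;> nlinarith [ih.1, ih.2]
  obtain ⟨M, hM⟩ := hb.exists_norm_le
  obtain ⟨n, hn⟩ := pow_unbounded_of_one_lt (M / ρ) (one_lt_two (α := ℝ))
  rw [div_lt_iff₀ hρ] at hn
  linarith [(hgrow n).2, hM _ ⟨n, rfl⟩]

/-- Write `p(z) = z g(z) + p(0)`. Since `g` is not constant, `|g| ≥ 3` far out, and one of the three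
multiples of `|z|` absorbs `p(0)`. -/
theorem exists_escape_radius {p : ℂ[X]} (hp : 2 ≤ p.natDegree) :
    ∃ ρ : ℝ, 0 < ρ ∧ ∀ z : ℂ, ρ ≤ ‖z‖ → 2 * ‖z‖ ≤ ‖p.eval z‖ := by
  have hdiv : 0 < p.divX.degree := by
    rw [← natDegree_pos_iff_degree_pos, natDegree_divX_eq_natDegree_tsub_one]
    omega
  have h := (p.divX.tendsto_norm_atTop hdiv (tendsto_norm_cobounded_atTop (E := ℂ))).eventually
    (Filter.eventually_ge_atTop 3)
  obtain ⟨r, -, hr⟩ := (Filter.HasBasis.cobounded_of_norm Filter.atTop_basis).eventually_iff.1 h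
  refine ⟨max (max r 1) ‖p.coeff 0‖, lt_max_of_lt_left (lt_max_of_lt_right one_pos), fun z hz => ?_⟩
  have h1 : 3 ≤ ‖p.divX.eval z‖ := hr (by
    simpa using (le_max_left _ _).trans ((le_max_left _ _).trans hz))
  have h2 : ‖p.coeff 0‖ ≤ ‖z‖ := (le_max_right _ _).trans hz
  have h3 : p.eval z = p.divX.eval z * z + p.coeff 0 := by
    conv_lhs => rw [← p.divX_mul_X_add]
    simp
  have h4 := norm_sub_le_norm_add (p.divX.eval z * z) (p.coeff 0)
  rw [h3]
  rw [norm_mul] at h4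
  nlinarith [norm_nonneg z]

theorem eval_mem_filledJulia_iff {p : ℂ[X]} {z : ℂ} :
    p.eval z ∈ filledJulia p ↔ z ∈ filledJulia p := by
  have h : (Set.range fun n : ℕ => (fun x => p.eval x)^[n] z) =
      insert z (Set.range fun n : ℕ => (fun x => p.eval x)^[n] (p.eval z)) := by
    ext w
    constructor
    · rintro ⟨n, rfl⟩
      cases n with
      | zero => exact Set.mem_insert _ _
      | succ n => exact Or.inr ⟨n, rfl⟩
    · rintro (rfl | ⟨n, rfl⟩)
      · exact ⟨0, rfl⟩
      · exact ⟨n + 1, rfl⟩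
  simp only [filledJulia, Set.mem_ofPred_eq]
  rw [h, Bornology.isBounded_insert]

theorem iterate_mem_filledJulia {p : ℂ[X]} {z : ℂ} (hz : z ∈ filledJulia p) (n : ℕ) :
    (fun x => p.eval x)^[n] z ∈ filledJulia p := by
  induction n with
  | zero => exact hz
  | succ n ih =>
    rw [Function.iterate_succ_apply']
    exact eval_mem_filledJulia_iff.2 ih

theorem isCompact_filledJulia {p : ℂ[X]} (hp : 2 ≤ p.natDegree) : IsCompact (filledJulia p) := by
  obtain ⟨ρ, hρ, hesc⟩ := exists_escape_radius hp
  have hle : ∀ z ∈ filledJulia p, ‖z‖ ≤ ρ := by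
    intro z hz
    refine (norm_lt_of_isBounded_range (x := fun n => (fun x => p.eval x)^[n] z) hρ ?_ hz).le
    intro n hn
    simp only [Function.iterate_succ_apply']
    exact hesc _ hn
  have heq : filledJulia p = ⋂ n : ℕ, {z | ‖(fun x => p.eval x)^[n] z‖ ≤ ρ} := by
    ext z
    simp only [Set.mem_iInter, Set.mem_ofPred_eq]
    refine ⟨fun hz n => hle _ (iterate_mem_filledJulia hz n), fun h => ?_⟩
    change Bornology.IsBounded (Set.range fun n : ℕ => (fun x => p.eval x)^[n] z)
    refine isBounded_iff_forall_norm_le.2 ⟨ρ, ?_⟩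
    rintro _ ⟨n, rfl⟩
    exact h n
  refine Metric.isCompact_of_isClosed_isBounded ?_ (isBounded_iff_forall_norm_le.2 ⟨ρ, hle⟩)
  rw [heq]
  exact isClosed_iInter fun n =>
    isClosed_le ((p.continuous.iterate n).norm) continuous_const

theorem julia_eq {p : ℂ[X]} (hp : 2 ≤ p.natDegree) :
    julia p = filledJulia p \ interior (filledJulia p) :=
  (isCompact_filledJulia hp).isClosed.frontier_eq

theorem iterate_mem_julia {p : ℂ[X]} (hp : 2 ≤ p.natDegree) {z : ℂ} (hz : z ∈ julia p) (n : ℕ) :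
    (fun x => p.eval x)^[n] z ∈ julia p := by
  induction n with
  | zero => exact hz
  | succ n ih =>
    rw [Function.iterate_succ_apply']
    rw [julia_eq hp] at ih ⊢
    refine ⟨eval_mem_filledJulia_iff.2 ih.1, fun hint => ih.2 ?_⟩
    refine mem_interior.2 ⟨(fun x => p.eval x) ⁻¹' interior (filledJulia p), fun w hw => ?_,
      isOpen_interior.preimage p.continuous, hint⟩
    exact eval_mem_filledJulia_iff.1 (interior_subset hw)

theorem isCompact_julia {p : ℂ[X]} (hp : 2 ≤ p.natDegree) : IsCompact (julia p) :=
  (isCompact_filledJulia hp).of_isClosed_subset isClosed_frontier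
    (by rw [julia_eq hp]; exact Set.sdiff_subset)

/-- At a superattracting fixed point `p` maps small disks into themselves. -/
theorem mem_nhds_filledJulia_of_derivative_eq_zero {p : ℂ[X]} {z : ℂ} (hz : p.eval z = z)
    (hd : (derivative p).eval z = 0) : filledJulia p ∈ nhds z := by
  have h := (p.hasDerivAt z).isLittleO.bound one_pos
  obtain ⟨δ, hδ, hball⟩ := Metric.eventually_nhds_iff_ball.1 h
  refine Filter.mem_of_superset (Metric.ball_mem_nhds z hδ) fun w hw => ?_
  refine Metric.isBounded_ball.subset (t := Metric.ball z δ) ?_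
  rintro _ ⟨n, rfl⟩
  induction n with
  | zero => exact hw
  | succ n ih =>
    simp only [Function.iterate_succ_apply']
    have h1 := hball _ ih
    simp only [hz, hd, smul_zero, sub_zero, one_mul] at h1
    rw [Metric.mem_ball, dist_eq_norm] at ih ⊢
    exact h1.trans_lt ih

/-- If `K_p` were finite, the surjection `p : K_p → K_p` would be injective. A fixed point would
then be its own only preimage, with multiplicity at least 2, hence superattracting and interior to
`K_p`. -/
theorem infinite_filledJulia {p : ℂ[X]} (hp : 2 ≤ p.natDegree) : (filledJulia p).Infinite := by
  intro hfin
  have hdX : ∀ q : ℂ[X], q.natDegree ≤ 1 → (p - q).natDegree = p.natDegree := fun q hq =>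
    natDegree_sub_eq_left_of_natDegree_lt (by omega)
  have hroot : ∀ q : ℂ[X], q.natDegree ≤ 1 → ∃ z, p.eval z = q.eval z := by
    intro q hq
    obtain ⟨z, hz⟩ := IsAlgClosed.exists_root (p - q) (by
      have h : 0 < (p - q).natDegree := by rw [hdX q hq]; omega
      exact (natDegree_pos_iff_degree_pos.1 h).ne')
    exact ⟨z, by simpa [sub_eq_zero] using hz⟩
  obtain ⟨z, hz⟩ := hroot X natDegree_X_le
  rw [eval_X] at hz
  have hzK : z ∈ filledJulia p := by
    refine (Bornology.isBounded_singleton (x := z)).subset ?_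
    rintro _ ⟨n, rfl⟩
    exact Function.iterate_fixed (f := fun x => p.eval x) hz n
  have hinj : Set.InjOn (fun x => p.eval x) (filledJulia p) := by
    have hmaps : Set.MapsTo (fun x => p.eval x) (filledJulia p) (filledJulia p) :=
      fun x hx => eval_mem_filledJulia_iff.2 hx
    have hsurj : Set.SurjOn (fun x => p.eval x) (filledJulia p) (filledJulia p) := by
      intro w hw
      obtain ⟨y, hy⟩ := hroot (C w) (by simp)
      rw [eval_C] at hy
      exact ⟨y, eval_mem_filledJulia_iff.1 (by rwa [hy]), hy⟩
    exact (hfin.surjOn_iff_bijOn_of_mapsTo hmaps).1 hsurj |>.injOn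
  have hdeg := hdX (C z) (by simp)
  have hne : p - C z ≠ 0 := fun h => by
    rw [h, natDegree_zero] at hdeg
    omega
  have hrep : (p - C z).roots = Multiset.replicate p.natDegree z := by
    rw [Multiset.eq_replicate]
    refine ⟨hdeg ▸ (IsAlgClosed.splits _).natDegree_eq_card_roots.symm, fun y hy => ?_⟩
    have hy' : p.eval y = z := by simpa [sub_eq_zero] using (mem_roots'.1 hy).2
    exact hinj (eval_mem_filledJulia_iff.1 (by rwa [hy'])) hzK (hy'.trans hz.symm)
  have hmult : 1 < (p - C z).rootMultiplicity z := by
    rw [← count_roots, hrep, Multiset.count_replicate_self]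
    omega
  have hd := ((one_lt_rootMultiplicity_iff_isRoot hne).1 hmult).2
  exact infinite_of_mem_nhds z (mem_nhds_filledJulia_of_derivative_eq_zero hz
    (by simpa using hd)) hfin

/-- The complement of a finite set is connected, so it lies in the interior of `K_p` or outside
`K_p`. The first makes `K_p` the whole plane; the second gives `K_p = J_p`, which is infinite. -/
theorem infinite_julia {p : ℂ[X]} (hp : 2 ≤ p.natDegree) : (julia p).Infinite := by
  intro hfin
  have hK := isCompact_filledJulia hp
  have hconn : IsConnected (julia p)ᶜ :=
    hfin.countable.isConnected_compl_of_one_lt_rank (by simp)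
  have hJ := julia_eq hp
  have hcov : (julia p)ᶜ ⊆ interior (filledJulia p) ∪ (filledJulia p)ᶜ := by
    intro w hw
    by_cases h : w ∈ filledJulia p
    · left
      by_contra h'
      exact hw (hJ ▸ ⟨h, h'⟩)
    · exact Or.inr h
  have hdisj : Disjoint (interior (filledJulia p)) (filledJulia p)ᶜ :=
    Set.disjoint_compl_right_iff_subset.2 interior_subset
  by_cases hint : (interior (filledJulia p)).Nonempty
  · obtain ⟨x, hx⟩ := hint
    have hsub := hconn.isPreconnected.subset_left_of_subset_union isOpen_interior
      hK.isClosed.isOpen_compl hdisj hcov ⟨x, fun h => (hJ ▸ h).2 hx, hx⟩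
    refine NormedSpace.unbounded_univ ℂ ℂ (hK.isBounded.subset fun w _ => ?_)
    by_cases h : w ∈ julia p
    · exact (hJ ▸ h).1
    · exact interior_subset (hsub h)
  · rw [Set.not_nonempty_iff_eq_empty.1 hint, Set.sdiff_empty] at hJ
    exact infinite_filledJulia hp (hJ ▸ hfin)

/-! ### Fibre polynomials and their iterates -/

variable {d : ℕ}

theorem eval_fiberPoly (lam : Param d) (z w : ℂ) :
    (fiberPoly lam z).eval w = w ^ d + ∑ j : Fin (d - 1), coeffA lam j z * w ^ (j : ℕ) := by
  simp [fiberPoly, eval_finsetSum]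

theorem natDegree_fiberPoly_tail_le (lam : Param d) (z : ℂ) :
    (∑ j : Fin (d - 1), C (coeffA lam j z) * X ^ (j : ℕ)).natDegree ≤ d - 2 := by
  refine natDegree_sum_le_of_forall_le _ _ fun j _ => (natDegree_C_mul_X_pow_le _ _).trans ?_
  have := j.2
  omega

theorem monic_fiberPoly (hd : 2 ≤ d) (lam : Param d) (z : ℂ) : (fiberPoly lam z).Monic := by
  refine monic_X_pow_add (degree_le_natDegree.trans_lt ?_)
  exact_mod_cast (natDegree_fiberPoly_tail_le lam z).trans_lt (by omega)

theorem natDegree_fiberPoly (hd : 2 ≤ d) (lam : Param d) (z : ℂ) :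
    (fiberPoly lam z).natDegree = d := by
  rw [fiberPoly, natDegree_add_eq_left_of_natDegree_lt, natDegree_X_pow]
  rw [natDegree_X_pow]
  exact (natDegree_fiberPoly_tail_le lam z).trans_lt (by omega)

theorem coeff_fiberPoly (lam : Param d) (z : ℂ) (j : Fin (d - 1)) :
    (fiberPoly lam z).coeff j = coeffA lam j z := by
  have hj := j.2
  have h : (j : ℕ) ≠ d := by omega
  simp [fiberPoly, coeff_X_pow, h, finsetSum_coeff, Fin.val_inj]

/-- The polynomial `Q^n_{λ,z}`. -/
noncomputable def fiberIterPoly (p : ℂ[X]) (lam : Param d) (z : ℂ) : ℕ → ℂ[X]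
  | 0 => X
  | n + 1 => (fiberPoly lam ((fun x => p.eval x)^[n] z)).comp (fiberIterPoly p lam z n)

theorem eval_fiberIterPoly (p : ℂ[X]) (lam : Param d) (z w : ℂ) (n : ℕ) :
    (fiberIterPoly p lam z n).eval w = fiberIter p lam z n w := by
  induction n with
  | zero => simp [fiberIterPoly, fiberIter]
  | succ n ih => simp [fiberIterPoly, fiberIter, ih]

theorem natDegree_fiberIterPoly (hd : 2 ≤ d) (p : ℂ[X]) (lam : Param d) (z : ℂ) (n : ℕ) :
    (fiberIterPoly p lam z n).natDegree = d ^ n := by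
  induction n with
  | zero => simp [fiberIterPoly]
  | succ n ih => rw [fiberIterPoly, natDegree_comp, ih, natDegree_fiberPoly hd, pow_succ']

theorem monic_fiberIterPoly (hd : 2 ≤ d) (p : ℂ[X]) (lam : Param d) (z : ℂ) (n : ℕ) :
    (fiberIterPoly p lam z n).Monic := by
  induction n with
  | zero => exact monic_X
  | succ n ih =>
    refine (monic_fiberPoly hd lam _).comp ih ?_
    rw [natDegree_fiberIterPoly hd]
    positivity

theorem nextCoeff_fiberIterPoly (hd : 2 ≤ d) (p : ℂ[X]) (lam : Param d) (z : ℂ) (n : ℕ) :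
    (fiberIterPoly p lam z n).nextCoeff = 0 := by
  induction n with
  | zero => simp [fiberIterPoly, nextCoeff]
  | succ n ih =>
    have hpos : 0 < d ^ n := by positivity
    have hdeg := natDegree_fiberIterPoly hd p lam z (n + 1)
    have hpos' : 0 < d ^ (n + 1) := by positivity
    set Q := fiberIterPoly p lam z n with hQ
    have hQd : Q.natDegree = d ^ n := natDegree_fiberIterPoly hd p lam z n
    have hQm : Q.Monic := monic_fiberIterPoly hd p lam z n
    have hpow : (Q ^ d).coeff (d ^ (n + 1) - 1) = 0 := by
      have h := hQm.nextCoeff_pow d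
      rw [ih, smul_zero, nextCoeff_of_natDegree_pos] at h
      · rwa [natDegree_pow, hQd, ← pow_succ'] at h
      · rw [natDegree_pow, hQd, ← pow_succ']
        exact hpos'
    rw [nextCoeff_of_natDegree_pos (hdeg ▸ hpos'), hdeg, fiberIterPoly, fiberPoly, add_comp,
      X_pow_comp, coeff_add, hpow, zero_add]
    -- The missing `w ^ (d - 1)` term leaves a gap: the lower terms composed with `Q` have degree at
    -- most `(d - 2) * d ^ n`, below `d ^ (n + 1) - 1`.
    refine coeff_eq_zero_of_natDegree_lt ?_
    rw [natDegree_comp, hQd]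
    calc _ ≤ (d - 2) * d ^ n := Nat.mul_le_mul_right _ (natDegree_fiberPoly_tail_le lam _)
      _ < d ^ (n + 1) - 1 := by
        obtain ⟨e, rfl⟩ := Nat.exists_eq_add_of_le' hd
        rw [pow_succ', Nat.add_sub_cancel, add_mul]
        omega

theorem sum_roots_fiberIterPoly (hd : 2 ≤ d) (p : ℂ[X]) (lam : Param d) (z : ℂ) (n : ℕ) :
    (fiberIterPoly p lam z n).roots.sum = 0 := by
  have h := (IsAlgClosed.splits _).nextCoeff_eq_neg_sum_roots_of_monic
    (monic_fiberIterPoly hd p lam z n)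
  rw [nextCoeff_fiberIterPoly hd] at h
  exact neg_eq_zero.1 h.symm

/-- By the chain rule, an orbit starting at a critical point of `Q^n_z` meets a critical point of
one of the fibre maps. -/
theorem exists_mem_critSet_of_derivative_eq_zero {p : ℂ[X]} {lam : Param d} {z c : ℂ} {n : ℕ}
    (h : (derivative (fiberIterPoly p lam z n)).eval c = 0) :
    ∃ k, fiberIter p lam z k c ∈ critSet lam ((fun x => p.eval x)^[k] z) := by
  induction n with
  | zero => simp [fiberIterPoly] at h
  | succ n ih =>
    rw [fiberIterPoly, derivative_comp, eval_mul, eval_comp, eval_fiberIterPoly] at h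
    rcases mul_eq_zero.1 h with h | h
    · exact ih h
    · exact ⟨n, h⟩

theorem fiberIter_succ' (p : ℂ[X]) (lam : Param d) (z w : ℂ) (n : ℕ) :
    fiberIter p lam z (n + 1) w = fiberIter p lam (p.eval z) n ((fiberPoly lam z).eval w) := by
  induction n with
  | zero => rfl
  | succ n ih =>
    rw [fiberIter, ih, fiberIter, Function.iterate_succ_apply]

theorem eval_mem_filledJuliaAbove_iff {p : ℂ[X]} {lam : Param d} {z w : ℂ} :
    (fiberPoly lam z).eval w ∈ filledJuliaAbove p lam (p.eval z) ↔
      w ∈ filledJuliaAbove p lam z := by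
  have h : (Set.range fun n : ℕ => fiberIter p lam z n w) = insert w
      (Set.range fun n : ℕ => fiberIter p lam (p.eval z) n ((fiberPoly lam z).eval w)) := by
    ext y
    constructor
    · rintro ⟨n, rfl⟩
      cases n with
      | zero => exact Set.mem_insert _ _
      | succ n => exact Or.inr ⟨n, (fiberIter_succ' p lam z w n).symm⟩
    · rintro (rfl | ⟨n, rfl⟩)
      · exact ⟨0, rfl⟩
      · exact ⟨n + 1, fiberIter_succ' p lam z w n⟩
  simp only [filledJuliaAbove, Set.mem_ofPred_eq]
  rw [h, Bornology.isBounded_insert]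

theorem fiberIter_mem_filledJuliaAbove_iff {p : ℂ[X]} {lam : Param d} {z w : ℂ} (n : ℕ) :
    fiberIter p lam z n w ∈ filledJuliaAbove p lam ((fun x => p.eval x)^[n] z) ↔
      w ∈ filledJuliaAbove p lam z := by
  induction n with
  | zero => rfl
  | succ n ih =>
    rw [← ih, Function.iterate_succ_apply', fiberIter, eval_mem_filledJuliaAbove_iff]

/-! ### Escape radius and the uniform bound on fibres -/

theorem two_mul_norm_le_norm_eval_fiberPoly (hd : 2 ≤ d) {lam : Param d} {z w : ℂ} {B : ℝ}
    (hB0 : 0 ≤ B) (hB : ∀ j, ‖coeffA lam j z‖ ≤ B) (hw : 2 + d * B ≤ ‖w‖) :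
    2 * ‖w‖ ≤ ‖(fiberPoly lam z).eval w‖ := by
  have hdB : 0 ≤ d * B := by positivity
  have hw1 : 1 ≤ ‖w‖ := by linarith
  have htail : ‖∑ j : Fin (d - 1), coeffA lam j z * w ^ (j : ℕ)‖ ≤ d * B * ‖w‖ ^ (d - 2) := by
    calc _ ≤ ∑ _j : Fin (d - 1), B * ‖w‖ ^ (d - 2) := by
          refine norm_sum_le_of_le _ fun j _ => ?_
          rw [norm_mul, norm_pow]
          have := j.2
          exact mul_le_mul (hB j) (pow_le_pow_right₀ hw1 (by omega)) (by positivity) hB0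
      _ = ((d - 1 : ℕ) : ℝ) * (B * ‖w‖ ^ (d - 2)) := by simp
      _ ≤ d * (B * ‖w‖ ^ (d - 2)) := by
          gcongr
          exact Nat.sub_le _ _
      _ = _ := by ring
  have h1 := norm_sub_le_norm_add (w ^ d) (∑ j : Fin (d - 1), coeffA lam j z * w ^ (j : ℕ))
  rw [eval_fiberPoly]
  have h2 : ‖w ^ d‖ = ‖w‖ ^ (d - 2) * ‖w‖ ^ 2 := by
    rw [norm_pow, ← pow_add, Nat.sub_add_cancel hd]
  have h3 : 1 ≤ ‖w‖ ^ (d - 2) := one_le_pow₀ hw1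
  have h4 : 2 * ‖w‖ ≤ ‖w‖ ^ 2 - d * B := by nlinarith
  have h5 : ‖w‖ ^ 2 - d * B ≤ ‖w‖ ^ (d - 2) * (‖w‖ ^ 2 - d * B) :=
    le_mul_of_one_le_left (by linarith) h3
  rw [h2] at h1
  linarith

theorem continuous_coeffA : Continuous fun x : Param d × ℂ =>
    (fun j => coeffA x.1 j x.2 : Fin (d - 1) → ℂ) := by
  unfold coeffA
  fun_prop

/-- The coefficients are bounded on the compact forward invariant set `J_p`, so one radius serves
along every orbit. It may depend on `lam`. -/
theorem exists_fiber_escape_radius (hd : 2 ≤ d) {p : ℂ[X]} (hp : p.natDegree = d)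
    (lam : Param d) :
    ∃ R : ℝ, 1 ≤ R ∧ ∀ z ∈ julia p, ∀ w ∈ filledJuliaAbove p lam z, ‖w‖ ≤ R := by
  have hp2 : 2 ≤ p.natDegree := hp ▸ hd
  obtain ⟨B, hB⟩ := (isCompact_julia hp2).exists_bound_of_continuousOn
    (continuous_coeffA.comp (Continuous.prodMk_right lam)).continuousOn
  have hBj : ∀ z ∈ julia p, ∀ j, ‖coeffA lam j z‖ ≤ max B 0 := fun z hz j =>
    ((norm_le_pi_norm (fun j => coeffA lam j z) j).trans (hB z hz)).trans (le_max_left _ _)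
  have hpos : 0 ≤ d * max B 0 := by positivity
  refine ⟨2 + d * max B 0, by linarith, fun z hz w hw => ?_⟩
  refine (norm_lt_of_isBounded_range (x := fun n => fiberIter p lam z n w) (by linarith)
    (fun n hn => ?_) hw).le
  exact two_mul_norm_le_norm_eval_fiberPoly hd (le_max_right _ _)
    (hBj _ (iterate_mem_julia hp2 hz n)) hn

theorem mem_connectednessLocus {p : ℂ[X]} {lam : Param d} : lam ∈ connectednessLocus d p ↔
    ∀ z ∈ julia p, ∀ c ∈ critSet lam z, c ∈ filledJuliaAbove p lam z := by
  simp [connectednessLocus]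

/-- For parameters in the connectedness locus, the fibres above the Julia set lie in a disk of
radius that does not depend on the parameter. -/
theorem norm_le_of_mem_filledJuliaAbove (hd : 2 ≤ d) {p : ℂ[X]} (hp : p.natDegree = d)
    {lam : Param d} (hlam : lam ∈ connectednessLocus d p) {z w : ℂ} (hz : z ∈ julia p)
    (hw : w ∈ filledJuliaAbove p lam z) : ‖w‖ ≤ 8 := by
  have hp2 : 2 ≤ p.natDegree := hp ▸ hd
  obtain ⟨R, hR1, hR⟩ := exists_fiber_escape_radius hd hp lam
  -- With `R ^ (1 / d ^ n) < 3 / 2`, roots have modulus below 6 and points of the fibre are within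
  -- `3 / 2` of a root; the sum is below 8.
  obtain ⟨n, hn⟩ := pow_unbounded_of_one_lt R (by norm_num : (1 : ℝ) < 3 / 2)
  have hRN : R < (3 / 2) ^ d ^ n :=
    hn.trans_le (pow_le_pow_right₀ (by norm_num) (Nat.lt_pow_self (by omega)).le)
  have hdeg := natDegree_fiberIterPoly hd p lam z n
  have hN : (fiberIterPoly p lam z n).natDegree ≠ 0 := by rw [hdeg]; positivity
  have hm := monic_fiberIterPoly hd p lam z n
  have hle : ∀ c ∈ filledJuliaAbove p lam z, ‖(fiberIterPoly p lam z n).eval c‖ ≤ R := by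
    intro c hc
    rw [eval_fiberIterPoly]
    exact hR _ (iterate_mem_julia hp2 hz n) _ ((fiberIter_mem_filledJuliaAbove_iff n).2 hc)
  have hcrit : ∀ c, (derivative (fiberIterPoly p lam z n)).eval c = 0 →
      ‖(fiberIterPoly p lam z n).eval c‖ ≤ R := by
    intro c hc
    obtain ⟨k, hk⟩ := exists_mem_critSet_of_derivative_eq_zero hc
    exact hle c ((fiberIter_mem_filledJuliaAbove_iff k).1
      (mem_connectednessLocus.1 hlam _ (iterate_mem_julia hp2 hz k) _ hk))
  obtain ⟨ζ, hζ, hwζ⟩ := exists_root_near (fiberIterPoly p lam z n) hN w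
  rw [hm, norm_one, one_mul, hdeg] at hwζ
  have h1 := norm_root_pow_le hm hN (sum_roots_fiberIterPoly hd p lam z n) (by linarith) hcrit hζ
  rw [hdeg] at h1
  have h2 : ‖w - ζ‖ < 3 / 2 :=
    lt_of_pow_lt_pow_left₀ _ (by norm_num) ((hwζ.trans (hle w hw)).trans_lt hRN)
  have h3 : ‖ζ‖ / 4 < 3 / 2 := lt_of_pow_lt_pow_left₀ _ (by norm_num) (h1.trans_lt hRN)
  have h4 := norm_add_le (w - ζ) ζ
  rw [sub_add_cancel] at h4
  linarith

/-! ### Boundedness of the locus -/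

theorem natDegree_derivative_fiberPoly (hd : 2 ≤ d) (lam : Param d) (z : ℂ) :
    (derivative (fiberPoly lam z)).natDegree = d - 1 := by
  rw [natDegree_derivative, natDegree_fiberPoly hd]

/-- A critical value `v` serves as a point known to lie in the fibre above `p(z)`. Its preimages lie
in `K_z`, hence in the disk of radius 8, and Vieta applies to `q_z - v`. The summand 8 pays for the
shift by `v` in the constant term. -/
theorem norm_coeffA_le (hd : 2 ≤ d) {p : ℂ[X]} (hp : p.natDegree = d)
    {lam : Param d} (hlam : lam ∈ connectednessLocus d p) {z : ℂ} (hz : z ∈ julia p)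
    (j : Fin (d - 1)) : ‖coeffA lam j z‖ ≤ 8 ^ d * 2 ^ d + 8 := by
  have hp2 : 2 ≤ p.natDegree := hp ▸ hd
  obtain ⟨c, hc⟩ := IsAlgClosed.exists_root (derivative (fiberPoly lam z)) (by
    refine (natDegree_pos_iff_degree_pos.1 ?_).ne'
    rw [natDegree_derivative_fiberPoly hd]
    omega)
  have hcK := mem_connectednessLocus.1 hlam z hz c hc
  set v := (fiberPoly lam z).eval c with hv
  have hvK : v ∈ filledJuliaAbove p lam (p.eval z) := eval_mem_filledJuliaAbove_iff.2 hcK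
  have hv8 : ‖v‖ ≤ 8 := norm_le_of_mem_filledJuliaAbove hd hp hlam (iterate_mem_julia hp2 hz 1) hvK
  have hdeg : (fiberPoly lam z - C v).natDegree = d := by
    rw [natDegree_sub_C, natDegree_fiberPoly hd]
  have hm : (fiberPoly lam z - C v).Monic := by
    refine (monic_fiberPoly hd lam z).sub_of_left ?_
    refine degree_C_le.trans_lt ?_
    rw [← natDegree_pos_iff_degree_pos, natDegree_fiberPoly hd]
    omega
  have hco := coeff_le_of_roots_le (f := RingHom.id ℂ) (B := 8) (j : ℕ) hm
    (IsAlgClosed.splits _) (by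
      intro y hy
      rw [map_id] at hy
      refine norm_le_of_mem_filledJuliaAbove hd hp hlam hz (eval_mem_filledJuliaAbove_iff.1 ?_)
      have : (fiberPoly lam z).eval y = v := by simpa [sub_eq_zero] using (mem_roots'.1 hy).2
      rwa [this])
  rw [map_id, hdeg, coeff_sub, coeff_fiberPoly] at hco
  have hC : ‖(C v).coeff j‖ ≤ 8 := by
    rw [coeff_C]
    split_ifs
    · exact hv8
    · simp
  have h1 : (8 : ℝ) ^ (d - (j : ℕ)) * (d.choose j : ℝ) ≤ 8 ^ d * 2 ^ d := by
    refine mul_le_mul (pow_le_pow_right₀ (by norm_num) (Nat.sub_le _ _)) ?_ (by positivity)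
      (by positivity)
    exact_mod_cast Nat.choose_le_two_pow d j
  have h2 := norm_add_le (coeffA lam j z - (C v).coeff j) ((C v).coeff j)
  rw [sub_add_cancel] at h2
  linarith

/-- Lagrange interpolation at `m` fixed points of `S` expresses the coefficient linearly in the
values there. -/
theorem exists_norm_coeff_le {S : Set ℂ} (hS : S.Infinite) (m k : ℕ) :
    ∃ M : ℝ, ∀ f : ℂ[X], f.degree < m → ∀ B : ℝ, (∀ z ∈ S, ‖f.eval z‖ ≤ B) →
      ‖f.coeff k‖ ≤ B * M := by
  obtain ⟨s, hsS, hcard⟩ := hS.exists_subset_card_eq m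
  refine ⟨∑ i ∈ s, ‖(Lagrange.basis s id i).coeff k‖, fun f hf B hB => ?_⟩
  rw [Lagrange.eq_interpolate (s := s) (v := id) (f := f) Function.injective_id.injOn
      (by rwa [hcard]),
    Lagrange.interpolate_apply, finsetSum_coeff, Finset.mul_sum]
  refine norm_sum_le_of_le _ fun i hi => ?_
  rw [coeff_C_mul, norm_mul]
  exact mul_le_mul_of_nonneg_right (hB i (hsS hi)) (norm_nonneg _)

theorem isBounded_connectednessLocus (hd : 2 ≤ d) {p : ℂ[X]} (hp : p.natDegree = d) :
    Bornology.IsBounded (connectednessLocus d p) := by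
  rw [← Bornology.forall_isBounded_image_eval_iff]
  rintro ⟨j, k⟩
  obtain ⟨M, hM⟩ := exists_norm_coeff_le (infinite_julia (hp ▸ hd : 2 ≤ p.natDegree))
    (d - (j : ℕ) + 1) k
  refine isBounded_iff_forall_norm_le.2 ⟨1 + |(8 ^ d * 2 ^ d + 8) * M|, ?_⟩
  rintro _ ⟨lam, hlam, rfl⟩
  set f : ℂ[X] := ∑ i : Fin (d - (j : ℕ) + 1), C (lam ⟨j, i⟩ ^ (d - (j : ℕ))) * X ^ (i : ℕ) with hf
  have hfdeg : f.degree < (d - (j : ℕ) + 1 : ℕ) := by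
    refine degree_le_natDegree.trans_lt (Nat.cast_lt.2 ?_)
    refine Nat.lt_succ_of_le (natDegree_sum_le_of_forall_le _ _ fun i _ => ?_)
    exact (natDegree_C_mul_X_pow_le _ _).trans (Nat.lt_succ_iff.1 i.2)
  have hfev : ∀ z, f.eval z = coeffA lam j z := fun z => by
    simp [hf, coeffA, eval_finsetSum]
  have hfc : f.coeff k = lam ⟨j, k⟩ ^ (d - (j : ℕ)) := by
    simp only [hf, finsetSum_coeff, coeff_C_mul, coeff_X_pow, Fin.val_inj]
    simp
  have h := hM f hfdeg (8 ^ d * 2 ^ d + 8) fun z hz => by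
    rw [hfev]
    exact norm_coeffA_le hd hp hlam hz j
  rw [hfc, norm_pow] at h
  change ‖lam ⟨j, k⟩‖ ≤ _
  -- Only the power `a_{j,k} ^ (d - j)` is controlled; beyond modulus 1 it dominates `a_{j,k}`
  -- itself.
  rcases le_or_gt ‖lam ⟨j, k⟩‖ 1 with h1 | h1
  · linarith [abs_nonneg ((8 ^ d * 2 ^ d + 8) * M)]
  · have hj := j.2
    have h2 := le_self_pow₀ h1.le (show d - (j : ℕ) ≠ 0 by omega)
    linarith [le_abs_self ((8 ^ d * 2 ^ d + 8) * M)]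

/-! ### Closedness of the locus -/

theorem continuous_fiberIter (p : ℂ[X]) (z : ℂ) (n : ℕ) :
    Continuous fun x : Param d × ℂ => fiberIter p x.1 z n x.2 := by
  induction n with
  | zero => exact continuous_snd
  | succ n ih =>
    simp only [fiberIter, eval_fiberPoly, coeffA]
    fun_prop

theorem continuous_eval_derivative_fiberPoly (z c : ℂ) :
    Continuous fun lam : Param d => (derivative (fiberPoly lam z)).eval c := by
  simp only [fiberPoly, coeffA, derivative_add, derivative_sum, eval_add, eval_finsetSum,
    derivative_C_mul, eval_mul, eval_C]
  fun_prop

theorem leadingCoeff_derivative_fiberPoly (hd : 2 ≤ d) (lam : Param d) (z : ℂ) :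
    (derivative (fiberPoly lam z)).leadingCoeff = d := by
  have h := (monic_fiberPoly hd lam z).coeff_natDegree
  rw [natDegree_fiberPoly hd] at h
  rw [leadingCoeff, natDegree_derivative_fiberPoly hd, coeff_derivative,
    Nat.sub_add_cancel (by omega), h, one_mul, ← Nat.cast_add_one, Nat.sub_add_cancel (by omega)]

/-- A violating critical point persists: for nearby parameters the derivative is small at `c` and
has leading coefficient `d`, so it has a root near `c`, where the strict inequality still holds. -/
theorem isClosed_setOf_critical_orbit_le (hd : 2 ≤ d) (p : ℂ[X]) (z : ℂ) (n : ℕ) (M : ℝ) :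
    IsClosed {lam : Param d | ∀ c ∈ critSet lam z, ‖fiberIter p lam z n c‖ ≤ M} := by
  rw [← isOpen_compl_iff, isOpen_iff_mem_nhds]
  intro lam hlam
  simp only [Set.mem_compl_iff, Set.mem_ofPred_eq, not_forall, not_le, exists_prop] at hlam
  obtain ⟨c, hc, hcM⟩ := hlam
  have hopen : IsOpen {x : Param d × ℂ | M < ‖fiberIter p x.1 z n x.2‖} :=
    isOpen_lt continuous_const (continuous_fiberIter p z n).norm
  obtain ⟨U, hU, V, hV, hUV⟩ := mem_nhds_prod_iff.1 (hopen.mem_nhds (x := (lam, c)) hcM)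
  obtain ⟨δ, hδ, hball⟩ := Metric.mem_nhds_iff.1 hV
  have hsmall : ∀ᶠ mu : Param d in nhds lam,
      ‖(derivative (fiberPoly mu z)).eval c‖ < δ ^ (d - 1) := by
    refine (continuous_eval_derivative_fiberPoly z c).norm.continuousAt.eventually_lt
      continuousAt_const ?_
    have hc0 : (derivative (fiberPoly lam z)).eval c = 0 := hc
    rw [hc0, norm_zero]
    positivity
  filter_upwards [hU, hsmall] with mu hmuU hmu hmem
  have hdeg := natDegree_derivative_fiberPoly hd mu z
  obtain ⟨ζ, hζ, hζle⟩ := exists_root_near (derivative (fiberPoly mu z)) (by omega) c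
  rw [hdeg, leadingCoeff_derivative_fiberPoly hd, Complex.norm_natCast] at hζle
  have hd1 : (1 : ℝ) ≤ d := by exact_mod_cast (by omega : 1 ≤ d)
  have h1 : ‖c - ζ‖ ^ (d - 1) < δ ^ (d - 1) :=
    ((le_mul_of_one_le_left (by positivity) hd1).trans hζle).trans_lt hmu
  have h2 : ‖c - ζ‖ < δ := lt_of_pow_lt_pow_left₀ _ hδ.le h1
  have h3 : ζ ∈ V := hball (by rwa [Metric.mem_ball, dist_comm, dist_eq_norm])
  have h4 : M < ‖fiberIter p mu z n ζ‖ := hUV (Set.mk_mem_prod hmuU h3)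
  exact absurd (hmem ζ hζ) (not_le.2 h4)

/-- A bounded critical orbit stays in the fibres above `J_p`, so the uniform radius 8 bounds every
one of its points. -/
theorem connectednessLocus_eq_iInter (hd : 2 ≤ d) {p : ℂ[X]} (hp : p.natDegree = d) :
    connectednessLocus d p = ⋂ z ∈ julia p, ⋂ n : ℕ,
      {lam | ∀ c ∈ critSet lam z, ‖fiberIter p lam z n c‖ ≤ 8} := by
  have hp2 : 2 ≤ p.natDegree := hp ▸ hd
  ext lam
  simp only [Set.mem_iInter, Set.mem_ofPred_eq]
  refine ⟨fun h z hz n c hc => ?_, fun h => mem_connectednessLocus.2 fun z hz c hc => ?_⟩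
  · exact norm_le_of_mem_filledJuliaAbove hd hp h (iterate_mem_julia hp2 hz n)
      ((fiberIter_mem_filledJuliaAbove_iff n).2 (mem_connectednessLocus.1 h z hz c hc))
  · change Bornology.IsBounded (Set.range fun n : ℕ => fiberIter p lam z n c)
    refine isBounded_iff_forall_norm_le.2 ⟨8, ?_⟩
    rintro _ ⟨n, rfl⟩
    exact h z hz n c hc

end SkewProduct

theorem mainTheorem10 (d : ℕ) (hd : 2 ≤ d) (p : Polynomial ℂ) (hp : p.natDegree = d) :
    IsCompact (SkewProduct.connectednessLocus d p) := by
  refine Metric.isCompact_of_isClosed_isBounded ?_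
    (SkewProduct.isBounded_connectednessLocus hd hp)
  rw [SkewProduct.connectednessLocus_eq_iInter hd hp]
  exact isClosed_biInter fun z _ => isClosed_iInter fun n =>
    SkewProduct.isClosed_setOf_critical_orbit_le hd p z n 8
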